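/- Let $\mathbf{Ban}$ be the category of complex Banach spaces and linear maps of norm $\le 1$, and let $\mathbf{CMet}$ be the category of complete metric spaces (with finite distances) and nonexpanding maps, i.e. maps $f$ with $d(f(x),f(y))\le d(x,y)$. Let $U:\mathbf{Ban}\to\mathbf{CMet}$ be the unit ball functor, which sends a Banach space $E$ to its closed unit ball $\{x\in E : \|x\|\le 1\}$ with the metric $d(x,y)=\|x-y\|$, and a morphism to its restriction to the closed unit balls. Then $U$ is monadic: $U$ has a left adjoint $F$, and the comparison functor from $\mathbf{Ban}$ to the category of Eilenberg–Moore algebras of the induced monad $UF$ on $\mathbf{CMet}$ is an equivalence of categories. -/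

import Mathlib

open CategoryTheory

universe u

/-- A complex Banach space. -/
structure Ban : Type (u + 1) where
  carrier : Type u
  [normedAddCommGroup : NormedAddCommGroup carrier]
  [normedSpace : NormedSpace ℂ carrier]
  [completeSpace : CompleteSpace carrier]

attribute [instance] Ban.normedAddCommGroup Ban.normedSpace Ban.completeSpace

namespace Ban

/-- A morphism of Banach spaces: a `ℂ`-linear map of operator norm at most `1`. -/
@[ext]
structure Hom (E F : Ban.{u}) : Type u where
  toCLM : E.carrier →L[ℂ] F.carrier
  norm_le_one : ‖toCLM‖ ≤ 1

/-- The category of complex Banach spaces and linear maps of norm at most `1`. -/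
instance : Category.{u} Ban.{u} where
  Hom E F := Hom E F
  id E := ⟨ContinuousLinearMap.id ℂ E.carrier, ContinuousLinearMap.norm_id_le⟩
  comp f g := ⟨g.toCLM.comp f.toCLM,
    (g.toCLM.opNorm_comp_le f.toCLM).trans
      (mul_le_one₀ g.norm_le_one (norm_nonneg _) f.norm_le_one)⟩

theorem Hom.norm_apply_le {E F : Ban.{u}} (f : E ⟶ F) (x : E.carrier) :
    ‖f.toCLM x‖ ≤ ‖x‖ := by
  simpa using f.toCLM.le_of_opNorm_le f.norm_le_one x

end Ban

/-- A complete metric space (possibly empty; all distances are finite). -/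
structure CMet : Type (u + 1) where
  carrier : Type u
  [metricSpace : MetricSpace carrier]
  [completeSpace : CompleteSpace carrier]

attribute [instance] CMet.metricSpace CMet.completeSpace

namespace CMet

/-- A morphism of complete metric spaces: a nonexpanding map. -/
@[ext]
structure Hom (X Y : CMet.{u}) : Type u where
  toFun : X.carrier → Y.carrier
  lipschitz : LipschitzWith 1 toFun

/-- The category of complete metric spaces and nonexpanding maps. -/
instance : Category.{u} CMet.{u} where
  Hom X Y := Hom X Y
  id X := ⟨_root_.id, LipschitzWith.id⟩
  comp f g := ⟨g.toFun ∘ f.toFun, by simpa using g.lipschitz.comp f.lipschitz⟩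

end CMet

/-- The closed unit ball of a Banach space, with the metric induced by the norm. -/
def Ban.closedUnitBall (E : Ban.{u}) : CMet.{u} where
  carrier := ↥(Metric.closedBall (0 : E.carrier) 1)
  completeSpace := Metric.isClosed_closedBall.completeSpace_coe

/-- The unit ball functor from complex Banach spaces to complete metric spaces: it sends a Banach
space to its closed unit ball and a morphism to its restriction to the closed unit balls. -/
def unitBallFunctor : Ban.{u} ⥤ CMet.{u} where
  obj E := E.closedUnitBall
  map {E F} f :=
    { toFun := fun x => (⟨f.toCLM x.1, mem_closedBall_zero_iff.2
        ((Ban.Hom.norm_apply_le f x.1).trans (mem_closedBall_zero_iff.1 x.2))⟩ :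
          ↥(Metric.closedBall (0 : F.carrier) 1))
      lipschitz := LipschitzWith.of_dist_le_mul fun x y => by
        have h := Ban.Hom.norm_apply_le f (x.1 - y.1)
        rw [map_sub, ← dist_eq_norm, ← dist_eq_norm] at h
        rw [NNReal.coe_one, one_mul]
        exact h }

/-! By Beck's monadicity theorem it suffices that `unitBallFunctor` has a left adjoint, reflects
isomorphisms, and preserves coequalizers of the pairs it splits; these coequalizers exist as
quotients by the closure of `range (f - g)`.

Preservation is the hard point. A splitting yields a nonlinear map `e = f ∘ t` on the unit ball of
`B`, and every `k` on balls that coequalizes `f` and `g` satisfies `k = k ∘ e`. So the pseudometric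
`ρ(x, y) = ‖e x - e y‖` has to be bounded by the quotient norm of `x - y` (`dist_le_norm_mk`).
Linearity of `f` and `g` makes `ρ` convex (`dist_convex_le`). After scaling down there is room in
the ball to add `f a - g a` without changing `e`, and convexity carries the estimate back to full
scale (`dist_le_of_smul`). Completeness then shows that the closed ball maps onto the closed ball of
the quotient (`exists_mk_eq`).

The left adjoint is the closed span of point evaluations on nonexpanding disc-valued maps;
Hahn–Banach gives its universal property (`exists_extension`). -/

/-! ### Convexity estimates for a split pair on unit balls. -/

/-- Data on the unit balls of two normed spaces which is left over from a pair of linear maps `f`,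
`g` whose restrictions to the unit balls form a split pair in metric spaces: `t` is a section of
`g` such that `f ∘ t` is nonexpanding and coequalizes `f` and `g`. -/
structure UnitBallSplitting {A B : Type*} [NormedAddCommGroup A] [NormedSpace ℝ A]
    [NormedAddCommGroup B] [NormedSpace ℝ B] (f g : A →ₗ[ℝ] B) (t : B → A) : Prop where
  norm_left_le : ∀ a, ‖f a‖ ≤ ‖a‖
  norm_right_le : ∀ a, ‖g a‖ ≤ ‖a‖
  norm_section_le : ∀ x, ‖x‖ ≤ 1 → ‖t x‖ ≤ 1
  right_section : ∀ x, ‖x‖ ≤ 1 → g (t x) = x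
  nonexpanding : ∀ x y, ‖x‖ ≤ 1 → ‖y‖ ≤ 1 → ‖f (t x) - f (t y)‖ ≤ ‖x - y‖
  coequalizes : ∀ a, ‖a‖ ≤ 1 → f (t (f a)) = f (t (g a))

theorem norm_smul_add_smul_le_one {E : Type*} [SeminormedAddCommGroup E] [NormedSpace ℝ E]
    {x y : E} {a b : ℝ} (hx : ‖x‖ ≤ 1) (hy : ‖y‖ ≤ 1) (ha : 0 ≤ a) (hb : 0 ≤ b)
    (hab : a + b ≤ 1) : ‖a • x + b • y‖ ≤ 1 := by
  calc ‖a • x + b • y‖ ≤ ‖a • x‖ + ‖b • y‖ := norm_add_le _ _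
    _ = a * ‖x‖ + b * ‖y‖ := by
      rw [norm_smul, norm_smul, Real.norm_of_nonneg ha, Real.norm_of_nonneg hb]
    _ ≤ 1 := by nlinarith

namespace UnitBallSplitting

variable {A B : Type*} [NormedAddCommGroup A] [NormedSpace ℝ A]
  [NormedAddCommGroup B] [NormedSpace ℝ B] {f g : A →ₗ[ℝ] B} {t : B → A}

/-- The coequalizing identity is applied to `a • t x + b • t y`: there `g` undoes `t`, while `f`
gives the combination of the values. -/
theorem apply_convex (h : UnitBallSplitting f g t) {x y : B} {a b : ℝ} (hx : ‖x‖ ≤ 1)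
    (hy : ‖y‖ ≤ 1) (ha : 0 ≤ a) (hb : 0 ≤ b) (hab : a + b ≤ 1) :
    f (t (a • x + b • y)) = f (t (a • f (t x) + b • f (t y))) := by
  have hw := h.coequalizes (a • t x + b • t y)
    (norm_smul_add_smul_le_one (h.norm_section_le x hx) (h.norm_section_le y hy) ha hb hab)
  simp only [map_add, map_smul, h.right_section x hx, h.right_section y hy] at hw
  exact hw.symm

theorem norm_apply_le (h : UnitBallSplitting f g t) {x : B} (hx : ‖x‖ ≤ 1) : ‖f (t x)‖ ≤ 1 :=
  (h.norm_left_le _).trans (h.norm_section_le x hx)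

theorem dist_convex_le (h : UnitBallSplitting f g t) {x y x' y' : B} {a b : ℝ} (hx : ‖x‖ ≤ 1)
    (hy : ‖y‖ ≤ 1) (hx' : ‖x'‖ ≤ 1) (hy' : ‖y'‖ ≤ 1) (ha : 0 ≤ a) (hb : 0 ≤ b)
    (hab : a + b ≤ 1) :
    ‖f (t (a • x + b • x')) - f (t (a • y + b • y'))‖ ≤
      a * ‖f (t x) - f (t y)‖ + b * ‖f (t x') - f (t y')‖ := by
  rw [h.apply_convex hx hx' ha hb hab, h.apply_convex hy hy' ha hb hab]
  refine (h.nonexpanding _ _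
    (norm_smul_add_smul_le_one (h.norm_apply_le hx) (h.norm_apply_le hx') ha hb hab)
    (norm_smul_add_smul_le_one (h.norm_apply_le hy) (h.norm_apply_le hy') ha hb hab)).trans ?_
  have : a • f (t x) + b • f (t x') - (a • f (t y) + b • f (t y')) =
      a • (f (t x) - f (t y)) + b • (f (t x') - f (t y')) := by module
  rw [this]
  refine (norm_add_le _ _).trans ?_
  rw [norm_smul, norm_smul, Real.norm_of_nonneg ha, Real.norm_of_nonneg hb]

theorem norm_smul_le_one {E : Type*} [SeminormedAddCommGroup E] [NormedSpace ℝ E]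
    {x : E} {a : ℝ} (hx : ‖x‖ ≤ 1) (ha : 0 ≤ a) (ha' : a ≤ 1) : ‖a • x‖ ≤ 1 := by
  rw [norm_smul, Real.norm_of_nonneg ha]
  exact mul_le_one₀ ha' (norm_nonneg _) hx

/-- Since `p * a = q`, the path from `p • a • x + q • x` to `p • a • y + q • y` can pass through `q
• x + q • y`; by convexity each leg costs `p` times the distance at scale `a`. Writing scales as `c
/ (1 + c)` turns the gain into doubling `c`. -/
theorem dist_smul_le_double (h : UnitBallSplitting f g t) {x y : B} (hx : ‖x‖ ≤ 1)
    (hy : ‖y‖ ≤ 1) {r c : ℝ} (hc : 0 < c)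
    (hr : ‖f (t ((c / (1 + c)) • x)) - f (t ((c / (1 + c)) • y))‖ ≤ c / (1 + c) * r) :
    ‖f (t ((2 * c / (1 + 2 * c)) • x)) - f (t ((2 * c / (1 + 2 * c)) • y))‖ ≤
      2 * c / (1 + 2 * c) * r := by
  set a := c / (1 + c) with ha
  have ha0 : 0 ≤ a := by positivity
  have ha1 : a ≤ 1 := by rw [ha, div_le_one (by positivity)]; linarith
  set p := (1 + c) / (1 + 2 * c) with hp
  set q := c / (1 + 2 * c) with hq
  have hp0 : 0 ≤ p := by positivity
  have hq0 : 0 ≤ q := by positivity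
  have hpq : p + q = 1 := by rw [hp, hq]; field_simp; ring
  have hpa : p * a = q := by rw [hp, hq, ha]; field_simp
  have hb : 2 * c / (1 + 2 * c) = p * a + q := by rw [hpa, hq]; ring
  have hax := norm_smul_le_one hx ha0 ha1
  have hay := norm_smul_le_one hy ha0 ha1
  have h1 := h.dist_convex_le hax hay hx hx hp0 hq0 hpq.le
  have h2 := h.dist_convex_le hax hay hy hy hp0 hq0 hpq.le
  have e1 : (p * a + q) • x = p • a • x + q • x := by module
  have e2 : (p * a + q) • y = p • a • y + q • y := by module
  have e5 : p • a • y + q • x = q • x + q • y := by rw [smul_smul, hpa, add_comm]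
  have e6 : p • a • x + q • y = q • x + q • y := by rw [smul_smul, hpa]
  rw [hb, e1, e2]
  rw [e5] at h1
  rw [e6] at h2
  simp only [sub_self, norm_zero, mul_zero, add_zero] at h1 h2
  have h3 := norm_sub_le_norm_sub_add_norm_sub (f (t (p • a • x + q • x)))
    (f (t (q • x + q • y))) (f (t (p • a • y + q • y)))
  have h4 := mul_le_mul_of_nonneg_left hr hp0
  have h5 : p * (a * r) + p * (a * r) = (p * a + q) * r := by rw [hpa, ← mul_assoc, hpa]; ring
  linarith

/-- Repeated doubling drives the scale to `1`, and restoring the unscaled points at scale `a` costs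
at most `1 - a` each. -/
theorem dist_le_of_smul (h : UnitBallSplitting f g t) {x y : B} (hx : ‖x‖ ≤ 1)
    (hy : ‖y‖ ≤ 1) {r c : ℝ} (hc : 0 < c)
    (hr : ‖f (t ((c / (1 + c)) • x)) - f (t ((c / (1 + c)) • y))‖ ≤ c / (1 + c) * r) :
    ‖f (t x) - f (t y)‖ ≤ r := by
  have hn : ∀ n : ℕ, ‖f (t ((2 ^ n * c / (1 + 2 ^ n * c)) • x)) -
      f (t ((2 ^ n * c / (1 + 2 ^ n * c)) • y))‖ ≤ 2 ^ n * c / (1 + 2 ^ n * c) * r := by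
    intro n
    induction n with
    | zero => simpa using hr
    | succ n ih =>
      have := h.dist_smul_le_double hx hy (by positivity) ih
      rwa [← mul_assoc, ← pow_succ'] at this
  have hbound : ∀ n : ℕ, ‖f (t x) - f (t y)‖ ≤ (2 ^ n * c / (1 + 2 ^ n * c)) * r +
      2 * (1 - 2 ^ n * c / (1 + 2 ^ n * c)) := by
    intro n
    have key := hn n
    set a := 2 ^ n * c / (1 + 2 ^ n * c) with ha
    have ha0 : 0 ≤ a := by positivity
    have ha1 : a ≤ 1 := by rw [ha, div_le_one (by positivity)]; linarith
    have move : ∀ z : B, ‖z‖ ≤ 1 → ‖f (t z) - f (t (a • z))‖ ≤ 1 - a := by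
      intro z hz
      refine (h.nonexpanding _ _ hz (norm_smul_le_one hz ha0 ha1)).trans ?_
      have : z - a • z = (1 - a) • z := by module
      rw [this, norm_smul, Real.norm_of_nonneg (by linarith)]
      nlinarith
    have h1 := move x hx
    have h2 := move y hy
    rw [norm_sub_rev] at h2
    have h3 := norm_sub_le_norm_sub_add_norm_sub (f (t x)) (f (t (a • x))) (f (t y))
    have h4 := norm_sub_le_norm_sub_add_norm_sub (f (t (a • x))) (f (t (a • y))) (f (t y))
    linarith
  have hlim : Filter.Tendsto (fun n : ℕ => 2 ^ n * c / (1 + 2 ^ n * c)) Filter.atTop (nhds 1) := by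
    have h1 : Filter.Tendsto (fun n : ℕ => (1 + 2 ^ n * c)⁻¹) Filter.atTop (nhds 0) :=
      (Filter.tendsto_atTop_add_const_left _ _
        ((tendsto_pow_atTop_atTop_of_one_lt one_lt_two).atTop_mul_const hc)).inv_tendsto_atTop
    have h2 := h1.const_sub 1
    rw [sub_zero] at h2
    refine h2.congr fun n => ?_
    have : (0 : ℝ) < 1 + 2 ^ n * c := by positivity
    field_simp
    ring
  have hlim' := (hlim.mul_const r).add ((hlim.const_sub 1).const_mul 2)
  rw [one_mul, sub_self, mul_zero, add_zero] at hlim'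
  exact ge_of_tendsto' hlim' hbound

/-- The pseudometric `‖f (t x) - f (t y)‖` is bounded by the distance modulo `range (f - g)`. -/
theorem dist_le_of_dist_range_le (h : UnitBallSplitting f g t) {x y : B} (hx : ‖x‖ ≤ 1)
    (hy : ‖y‖ ≤ 1) {r : ℝ} (a : A) (hr : ‖x - y - (f a - g a)‖ ≤ r) :
    ‖f (t x) - f (t y)‖ ≤ r := by
  have hA := norm_nonneg a
  -- Chosen so that `s = c / (1 + c)` equals `1 / (2 * (1 + ‖a‖))`: scaling by `2 * s` brings
  -- vectors of norm at most `1 + ‖a‖` into the unit ball.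
  set c : ℝ := 1 / (1 + 2 * ‖a‖) with hc
  have hc0 : 0 < c := by positivity
  refine h.dist_le_of_smul hx hy hc0 ?_
  set s := c / (1 + c) with hs
  have hs' : s = 1 / (2 * (1 + ‖a‖)) := by rw [hs, hc]; field_simp; ring
  have hs0 : 0 ≤ s := by positivity
  have hs2 : 2 * s * (1 + ‖a‖) = 1 := by rw [hs']; field_simp
  have hs1 : s ≤ 1 := by nlinarith
  have hfa := h.norm_left_le a
  have hga := h.norm_right_le a
  have small : ∀ z : B, ‖z‖ ≤ 1 + ‖a‖ → ‖(2 * s) • z‖ ≤ 1 := by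
    intro z hz
    rw [norm_smul, Real.norm_of_nonneg (by positivity)]
    nlinarith
  have hv : ‖(2 * s) • (y - g a)‖ ≤ 1 := small _ ((norm_sub_le _ _).trans (by linarith))
  have hf := small (f a) (by linarith)
  have hg := small (g a) (by linarith)
  -- The points `s • (y + (f a - g a))` and `s • y` are midpoints with the common endpoint `(2 * s)
  -- • (y - g a)`; their other endpoints `(2 * s) • f a` and `(2 * s) • g a` are identified by `f ∘
  -- t`.
  have h1 := h.dist_convex_le (a := 1 / 2) (b := 1 / 2) hv hv hf hg (by norm_num) (by norm_num)
    (by norm_num)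
  have hp := norm_smul_add_smul_le_one (a := 1 / 2) (b := 1 / 2) hv hf (by norm_num)
    (by norm_num) (by norm_num)
  have e1 : (1 / 2 : ℝ) • (2 * s) • (y - g a) + (1 / 2 : ℝ) • (2 * s) • f a =
      s • (y + (f a - g a)) := by module
  have e2 : (1 / 2 : ℝ) • (2 * s) • (y - g a) + (1 / 2 : ℝ) • (2 * s) • g a = s • y := by module
  have hz : f (t ((2 * s) • f a)) = f (t ((2 * s) • g a)) := by
    have hn : ‖(2 * s) • a‖ ≤ 1 := by
      rw [norm_smul, Real.norm_of_nonneg (by positivity)]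
      nlinarith
    simpa only [map_smul] using h.coequalizes ((2 * s) • a) hn
  rw [e1] at hp
  rw [e1, e2, hz] at h1
  simp only [sub_self, norm_zero, mul_zero, add_zero] at h1
  have h2 := h.nonexpanding _ _ (norm_smul_le_one hx hs0 hs1) hp
  have e3 : s • x - s • (y + (f a - g a)) = s • (x - y - (f a - g a)) := by module
  rw [e3, norm_smul, Real.norm_of_nonneg hs0] at h2
  have h3 := norm_sub_le_norm_sub_add_norm_sub (f (t (s • x)))
    (f (t (s • (y + (f a - g a))))) (f (t (s • y)))
  have h4 := mul_le_mul_of_nonneg_left hr hs0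
  linarith

end UnitBallSplitting

/-! ### The quotient by the closure of `range (f - g)`. -/

instance Submodule.isClosed_coe_topologicalClosure {E : Type*} [NormedAddCommGroup E]
    [NormedSpace ℂ E] (S : Submodule ℂ E) : IsClosed (S.topologicalClosure : Set E) :=
  S.isClosed_topologicalClosure

namespace UnitBallSplitting

variable {A B : Type*} [NormedAddCommGroup A] [NormedSpace ℂ A]
  [NormedAddCommGroup B] [NormedSpace ℂ B] {f g : A →L[ℂ] B} {t : B → A}

/-- Up to `ε`, the quotient norm is that of a representative `m`, and `x - y - m`, lying in the
closure, is approximated by some `f a - g a`. -/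
theorem dist_le_norm_mk
    (h : UnitBallSplitting (f.toLinearMap.restrictScalars ℝ) (g.toLinearMap.restrictScalars ℝ) t)
    {x y : B} (hx : ‖x‖ ≤ 1) (hy : ‖y‖ ≤ 1) :
    ‖f (t x) - f (t y)‖ ≤
      ‖(Submodule.Quotient.mk x - Submodule.Quotient.mk y :
        B ⧸ (LinearMap.range (f - g).toLinearMap).topologicalClosure)‖ := by
  refine le_of_forall_pos_le_add fun ε hε => ?_
  obtain ⟨m, hm, hmε⟩ := Submodule.Quotient.norm_mk_lt
    (Submodule.Quotient.mk x - Submodule.Quotient.mk y :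
      B ⧸ (LinearMap.range (f - g).toLinearMap).topologicalClosure) (half_pos hε)
  rw [← Submodule.Quotient.mk_sub, eq_comm, Submodule.Quotient.eq] at hm
  obtain ⟨_, ⟨a, rfl⟩, ha⟩ := Metric.mem_closure_iff.1 hm (ε / 2) (half_pos hε)
  refine h.dist_le_of_dist_range_le hx hy a ?_
  have e : x - y - (f a - g a) = m + (x - y - m - (f a - g a)) := by abel
  have ha' : ‖x - y - m - (f a - g a)‖ < ε / 2 := by simpa [dist_eq_norm] using ha
  change ‖x - y - (f a - g a)‖ ≤ _
  rw [e]
  refine (norm_add_le _ _).trans ?_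
  linarith

theorem mk_apply_section
    (h : UnitBallSplitting (f.toLinearMap.restrictScalars ℝ) (g.toLinearMap.restrictScalars ℝ) t)
    {x : B} (hx : ‖x‖ ≤ 1) :
    (Submodule.Quotient.mk (f (t x)) :
      B ⧸ (LinearMap.range (f - g).toLinearMap).topologicalClosure) = Submodule.Quotient.mk x := by
  rw [Submodule.Quotient.eq]
  refine Submodule.le_topologicalClosure _ ⟨t x, ?_⟩
  have : g (t x) = x := h.right_section x hx
  simp [this]

/-- The quotient map by the closure of `range (f - g)` maps the closed unit ball onto the closed
unit ball. -/
theorem exists_mk_eq [CompleteSpace B]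
    (h : UnitBallSplitting (f.toLinearMap.restrictScalars ℝ) (g.toLinearMap.restrictScalars ℝ) t)
    (z : B ⧸ (LinearMap.range (f - g).toLinearMap).topologicalClosure) (hz : ‖z‖ ≤ 1) :
    ∃ x : B, ‖x‖ ≤ 1 ∧ Submodule.Quotient.mk x = z := by
  -- The infimum defining the quotient norm need not be attained, so `z` is shrunk to norm below `1`
  -- to obtain lifts in the unit ball.
  let c : ℕ → ℂ := fun n => ((n / (n + 1) : ℝ) : ℂ)
  have hc : Filter.Tendsto c Filter.atTop (nhds 1) := by
    have := (Complex.continuous_ofReal.tendsto 1).comp (tendsto_natCast_div_add_atTop (1 : ℝ))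
    rwa [Complex.ofReal_one] at this
  have hcz : Filter.Tendsto (fun n => c n • z) Filter.atTop (nhds z) := by
    simpa using hc.smul_const z
  have hlt : ∀ n, ‖c n • z‖ < 1 := by
    intro n
    have h1 : ‖c n‖ < 1 := by
      rw [Complex.norm_real, Real.norm_of_nonneg (by positivity), div_lt_one (by positivity)]
      linarith
    rw [norm_smul]
    have := norm_nonneg (c n)
    nlinarith [norm_nonneg z]
  have hex : ∀ n, ∃ x : B, Submodule.Quotient.mk x = c n • z ∧ ‖x‖ ≤ 1 := by
    intro n
    obtain ⟨x, hx, hx'⟩ := Submodule.Quotient.norm_mk_lt (c n • z) (sub_pos.2 (hlt n))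
    exact ⟨x, hx, by linarith⟩
  choose x hx hx1 using hex
  -- The lifts `x n` need not converge, but `f (t (x n))` has the same class as `x n`, and its
  -- distances are controlled by those in the quotient.
  have hcau : CauchySeq fun n => f (t (x n)) := by
    have hcz' := Metric.cauchySeq_iff.1 hcz.cauchySeq
    refine Metric.cauchySeq_iff.2 fun ε hε => ?_
    obtain ⟨N, hN⟩ := hcz' ε hε
    refine ⟨N, fun m hm n hn => ?_⟩
    have h1 := h.dist_le_norm_mk (hx1 m) (hx1 n)
    have h2 := hN m hm n hn
    rw [hx, hx, ← dist_eq_norm, ← dist_eq_norm] at h1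
    exact h1.trans_lt h2
  obtain ⟨b, hb⟩ := cauchySeq_tendsto_of_complete hcau
  refine ⟨b, le_of_tendsto' hb.norm fun n => h.norm_apply_le (hx1 n), ?_⟩
  have hmk := ((LinearMap.range (f - g).toLinearMap).topologicalClosure.mkQL.continuous.tendsto
    b).comp hb
  refine tendsto_nhds_unique hmk (hcz.congr fun n => ?_)
  rw [← hx n, ← h.mk_apply_section (hx1 n)]
  rfl

end UnitBallSplitting

/-! ### The free Banach space on a metric space. -/

noncomputable section

/-- Nonexpanding functions from a metric space to the closed unit disc, with the topology of
pointwise convergence. -/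
abbrev NonexpandingDiscMap (X : Type*) [MetricSpace X] : Type _ :=
  {φ : X → ℂ // LipschitzWith 1 φ ∧ ∀ x, ‖φ x‖ ≤ 1}

namespace FreeBanach

open BoundedContinuousFunction

/-- Evaluation at a point, as a bounded function on the space of nonexpanding functions to the
closed unit disc. -/
def eval {X : Type*} [MetricSpace X] (x : X) : NonexpandingDiscMap X →ᵇ ℂ :=
  .ofNormedAddCommGroup (fun φ => φ.1 x) ((continuous_apply x).comp continuous_subtype_val) 1
    fun φ => φ.2.2 x

theorem norm_eval_le {X : Type*} [MetricSpace X] (x : X) : ‖eval x‖ ≤ 1 :=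
  norm_ofNormedAddCommGroup_le _ zero_le_one _

theorem lipschitzWith_eval {X : Type*} [MetricSpace X] : LipschitzWith 1 (eval (X := X)) := by
  refine LipschitzWith.of_dist_le_mul fun x y => ?_
  rw [dist_le (by positivity)]
  exact fun φ => φ.2.1.dist_le_mul x y

/-- The closed span of the point evaluations. -/
def closedSpan (X : Type*) [MetricSpace X] : Submodule ℂ (NonexpandingDiscMap X →ᵇ ℂ) :=
  (Submodule.span ℂ (Set.range eval)).topologicalClosure

instance (X : Type*) [MetricSpace X] : CompleteSpace (closedSpan X) :=
  (Submodule.isClosed_topologicalClosure _).completeSpace_coe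

theorem eval_mem {X : Type*} [MetricSpace X] (x : X) : eval x ∈ closedSpan X :=
  Submodule.le_topologicalClosure _ (Submodule.subset_span ⟨x, rfl⟩)

theorem closedSpan_ext {X : Type*} [MetricSpace X] {E : Type*} [NormedAddCommGroup E]
    [NormedSpace ℂ E] {f g : closedSpan X →L[ℂ] E}
    (h : ∀ x, f ⟨eval x, eval_mem x⟩ = g ⟨eval x, eval_mem x⟩) : f = g := by
  have hle : closedSpan X ≤ (LinearMap.eqLocus f.toLinearMap g.toLinearMap).map (closedSpan X).subtype := by
    refine Submodule.topologicalClosure_minimal _ (Submodule.span_le.2 ?_) ?_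
    · rintro _ ⟨x, rfl⟩
      exact ⟨⟨eval x, eval_mem x⟩, h x, rfl⟩
    · rw [Submodule.map_coe]
      exact (Submodule.isClosed_topologicalClosure _).isClosedEmbedding_subtypeVal.isClosedMap _
        (isClosed_eq f.continuous g.continuous)
  ext ⟨ξ, hξ⟩
  obtain ⟨η, hη, hηξ⟩ := hle hξ
  obtain rfl : η = ⟨ξ, hξ⟩ := Subtype.ext hηξ
  exact hη

variable {E : Type*} [NormedAddCommGroup E] [NormedSpace ℂ E]

theorem norm_apply_le_of_mem_dualBall (ψ : Metric.closedBall (0 : StrongDual ℂ E) 1) (y : E) :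
    ‖ψ.1 y‖ ≤ ‖y‖ := by
  simpa using ψ.1.le_of_opNorm_le (mem_closedBall_zero_iff.1 ψ.2) y

/-- Evaluation at a vector, as a bounded continuous function on the closed unit ball of the
dual. -/
def dualBallEval (y : E) : Metric.closedBall (0 : StrongDual ℂ E) 1 →ᵇ ℂ :=
  .ofNormedAddCommGroup (fun ψ => ψ.1 y) (by fun_prop) ‖y‖ (norm_apply_le_of_mem_dualBall · y)

/-- The isometric embedding of a normed space into the bounded continuous functions on the closed
unit ball of its dual. -/
def toDualBall (E : Type*) [NormedAddCommGroup E] [NormedSpace ℂ E] :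
    E →ₗᵢ[ℂ] (Metric.closedBall (0 : StrongDual ℂ E) 1 →ᵇ ℂ) where
  toFun := dualBallEval
  map_add' x y := by ext ψ; exact map_add ψ.1 x y
  map_smul' c x := by ext ψ; exact map_smul ψ.1 c x
  norm_map' y := by
    refine le_antisymm (norm_ofNormedAddCommGroup_le _ (norm_nonneg y)
      (norm_apply_le_of_mem_dualBall · y)) ?_
    obtain ⟨ψ, hψ, hψy⟩ := exists_dual_vector'' ℂ y
    have := (dualBallEval y).norm_coe_le_norm ⟨ψ, mem_closedBall_zero_iff.2 hψ⟩
    change ‖ψ y‖ ≤ _ at this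
    rw [hψy] at this
    simpa using this

/-- Precomposition of functionals in the dual unit ball with a nonexpanding map to the unit
ball. -/
def precomp {X : Type*} [MetricSpace X] (k : X → E) (hk : LipschitzWith 1 k)
    (hk1 : ∀ x, ‖k x‖ ≤ 1) : C(Metric.closedBall (0 : StrongDual ℂ E) 1, NonexpandingDiscMap X) where
  toFun ψ := ⟨fun x => ψ.1 (k x), by
    have hψ : ‖ψ.1‖₊ ≤ 1 := mem_closedBall_zero_iff.1 ψ.2
    have := (ψ.1.lipschitz.weaken hψ).comp hk
    rw [one_mul] at this
    exact this,
    fun x => ((ψ.1.le_of_opNorm_le (mem_closedBall_zero_iff.1 ψ.2) _).trans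
      (by simpa using hk1 x))⟩
  continuous_toFun := by fun_prop

/-- Pulling back along `ψ ↦ ψ ∘ k` is contractive and sends `eval x` to the image of `k x` under
`toDualBall E`. That image of `E` is closed because `E` is complete, so the whole closed span lands
in it. -/
theorem exists_extension [CompleteSpace E] {X : Type*} [MetricSpace X] (k : X → E)
    (hk : LipschitzWith 1 k) (hk1 : ∀ x, ‖k x‖ ≤ 1) :
    ∃ F : closedSpan X →L[ℂ] E, ‖F‖ ≤ 1 ∧ ∀ x, F ⟨eval x, eval_mem x⟩ = k x := by
  let T : (NonexpandingDiscMap X →ᵇ ℂ) →ₗ[ℂ] (Metric.closedBall (0 : StrongDual ℂ E) 1 →ᵇ ℂ) :=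
    { toFun := fun ξ => ξ.compContinuous (precomp k hk hk1)
      map_add' := fun _ _ => rfl
      map_smul' := fun _ _ => rfl }
  have hT : ∀ ξ, ‖T ξ‖ ≤ ‖ξ‖ := fun ξ =>
    (norm_le (norm_nonneg ξ)).2 fun ψ => ξ.norm_coe_le_norm _
  have hTc : Continuous T := (T.mkContinuous 1 (by simpa using hT)).continuous
  have hle : closedSpan X ≤ (LinearMap.range (toDualBall E).toLinearMap).comap T := by
    refine Submodule.topologicalClosure_minimal _ (Submodule.span_le.2 ?_) ?_
    · rintro _ ⟨x, rfl⟩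
      exact ⟨k x, rfl⟩
    · rw [Submodule.comap_coe]
      refine IsClosed.preimage hTc ?_
      have := (toDualBall E).isometry.isClosedEmbedding.isClosed_range
      convert this
      ext; simp
  let J := (toDualBall E).equivRange
  let T' : closedSpan X →ₗ[ℂ] LinearMap.range (toDualBall E).toLinearMap := T.restrict hle
  let F : closedSpan X →ₗ[ℂ] E := J.symm.toLinearEquiv.toLinearMap ∘ₗ T'
  have hF : ∀ ξ, ‖F ξ‖ ≤ 1 * ‖ξ‖ := fun ξ => by
    rw [one_mul]
    refine (J.symm.norm_map _).trans_le (hT ξ.1)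
  refine ⟨F.mkContinuous 1 hF, F.mkContinuous_norm_le zero_le_one hF, fun x => ?_⟩
  change J.symm _ = _
  rw [LinearIsometryEquiv.symm_apply_eq]
  rfl

end FreeBanach

open Limits

/-- The free Banach space on a complete metric space. -/
def freeBanach (X : CMet.{u}) : Ban.{u} where
  carrier := FreeBanach.closedSpan X.carrier

/-- The point of the free Banach space given by a point of the metric space. -/
def freeBanachUnit (X : CMet.{u}) (x : X.carrier) : (freeBanach X).carrier :=
  (⟨FreeBanach.eval x, FreeBanach.eval_mem x⟩ : FreeBanach.closedSpan X.carrier)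

/-- The universal property of the free Banach space. -/
def freeBanachHomEquiv (X : CMet.{u}) (E : Ban.{u}) :
    (freeBanach X ⟶ E) ≃ (X ⟶ unitBallFunctor.obj E) :=
  Equiv.ofBijective
    (fun F => (⟨fun x => ⟨F.toCLM (freeBanachUnit X x),
        mem_closedBall_zero_iff.2
          ((Ban.Hom.norm_apply_le F _).trans (FreeBanach.norm_eval_le x))⟩,
      LipschitzWith.of_dist_le_mul fun x y => by
        have h := Ban.Hom.norm_apply_le F (freeBanachUnit X x - freeBanachUnit X y)
        rw [map_sub, ← dist_eq_norm] at h
        exact h.trans ((dist_eq_norm (FreeBanach.eval x) (FreeBanach.eval y)).symm.trans_le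
          (FreeBanach.lipschitzWith_eval.dist_le_mul x y))⟩ : CMet.Hom X E.closedUnitBall))
    ⟨fun F G h => Ban.Hom.ext (FreeBanach.closedSpan_ext fun x =>
        congrArg Subtype.val (congrFun (congrArg CMet.Hom.toFun h) x)),
      fun k => by
        obtain ⟨F, hF, hk⟩ := FreeBanach.exists_extension
          (fun x => (k.toFun x : Metric.closedBall (0 : E.carrier) 1).1)
          (fun x y => k.lipschitz x y) (fun x => mem_closedBall_zero_iff.1 (k.toFun x).2)
        exact ⟨⟨F, hF⟩, CMet.Hom.ext (funext fun x => Subtype.ext (hk x))⟩⟩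

/-- The free Banach space functor is left adjoint to the unit ball functor. -/
def freeBanachAdjunction : Adjunction.leftAdjointOfEquiv (G := unitBallFunctor.{u})
    freeBanachHomEquiv (fun _ _ _ _ _ => rfl) ⊣ unitBallFunctor.{u} :=
  Adjunction.adjunctionOfEquivLeft _ _

/-! ### Coequalizers of Banach spaces. -/

namespace Ban

variable {A B : Ban.{u}} (f g : A ⟶ B)

/-- The closure of the range of the difference of two morphisms. -/
def rangeSub : Submodule ℂ B.carrier :=
  (LinearMap.range (f.toCLM - g.toCLM).toLinearMap).topologicalClosure

instance : IsClosed (rangeSub f g : Set B.carrier) :=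
  Submodule.isClosed_topologicalClosure _

/-- The coequalizer of two morphisms of Banach spaces. -/
def coeq : Ban.{u} where
  carrier := B.carrier ⧸ rangeSub f g

/-- The projection to the coequalizer. -/
def coeqπ : B ⟶ coeq f g :=
  (⟨(rangeSub f g).mkQL, ContinuousLinearMap.opNorm_le_bound _ zero_le_one fun x => by
    rw [one_mul]; exact Submodule.Quotient.norm_mk_le _ x⟩ : Hom B (coeq f g))

theorem coeq_condition : f ≫ coeqπ f g = g ≫ coeqπ f g := by
  refine Hom.ext (ContinuousLinearMap.ext fun a => ?_)
  refine (Submodule.Quotient.eq _).2 (Submodule.le_topologicalClosure _ ⟨a, rfl⟩)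

variable {f g}

theorem rangeSub_le_ker {E : Ban.{u}} (k : B ⟶ E) (hk : f ≫ k = g ≫ k) :
    rangeSub f g ≤ k.toCLM.ker := by
  refine Submodule.topologicalClosure_minimal _ ?_ k.toCLM.isClosed_ker
  rintro _ ⟨a, rfl⟩
  have h : k.toCLM (f.toCLM a) = k.toCLM (g.toCLM a) :=
    congrArg (fun l : Hom A E => l.toCLM a) hk
  simp [h]

/-- The morphism induced on the coequalizer. -/
def coeqDesc {E : Ban.{u}} (k : B ⟶ E) (hk : f ≫ k = g ≫ k) : coeq f g ⟶ E :=
  (⟨(rangeSub f g).liftQL k.toCLM (rangeSub_le_ker k hk),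
    ContinuousLinearMap.opNorm_le_bound _ zero_le_one fun z => by
      rw [one_mul]
      refine le_of_forall_pos_le_add fun ε hε => ?_
      obtain ⟨x, rfl, hx⟩ := Submodule.Quotient.norm_mk_lt z hε
      exact (Hom.norm_apply_le k x).trans hx.le⟩ : Hom (coeq f g) E)

variable (f g) in
/-- The projection to the quotient is a coequalizer in Banach spaces. -/
def coeqIsColimit : IsColimit (Cofork.ofπ (coeqπ f g) (coeq_condition f g)) :=
  Cofork.IsColimit.mk' _ fun s => ⟨coeqDesc s.π s.condition, rfl, fun {m} hm =>
    Hom.ext (ContinuousLinearMap.ext fun z => by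
      obtain ⟨x, rfl⟩ := Submodule.Quotient.mk_surjective _ z
      exact congrArg (fun l : Hom B s.pt => l.toCLM x) hm)⟩

instance (f g : A ⟶ B) : HasCoequalizer f g := ⟨⟨_, coeqIsColimit f g⟩⟩

end Ban

/-! ### Preservation of coequalizers of split pairs. -/

/-- In the split coequalizer, `f ∘ t` factors as the coequalizing map followed by its section, hence
is nonexpanding and coequalizes the pair. -/
theorem exists_unitBallSplitting {A B : Ban.{u}} (f g : A ⟶ B)
    [unitBallFunctor.IsSplitPair f g] :
    ∃ t : B.carrier → A.carrier,
      UnitBallSplitting (f.toCLM.toLinearMap.restrictScalars ℝ)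
        (g.toCLM.toLinearMap.restrictScalars ℝ) t := by
  obtain ⟨Z, h, ⟨S⟩⟩ := HasSplitCoequalizer.splittable (f := unitBallFunctor.map f)
    (g := unitBallFunctor.map g)
  have ht : ∀ x : Metric.closedBall (0 : B.carrier) 1,
      (unitBallFunctor.map g).toFun (S.leftSection.toFun x) = x := fun x =>
    congrFun (congrArg CMet.Hom.toFun S.leftSection_bottom) x
  have ht' : ∀ x : Metric.closedBall (0 : B.carrier) 1,
      (unitBallFunctor.map f).toFun (S.leftSection.toFun x) = S.rightSection.toFun (h.toFun x) :=
    fun x => congrFun (congrArg CMet.Hom.toFun S.leftSection_top) x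
  have hc : ∀ a : Metric.closedBall (0 : A.carrier) 1,
      h.toFun ((unitBallFunctor.map f).toFun a) = h.toFun ((unitBallFunctor.map g).toFun a) :=
    fun a => congrFun (congrArg CMet.Hom.toFun S.condition) a
  classical
  let s : Metric.closedBall (0 : B.carrier) 1 → Metric.closedBall (0 : A.carrier) 1 :=
    S.leftSection.toFun
  -- The value `0` outside the ball is arbitrary: all conditions on `t` concern unit vectors and
  -- shorter ones.
  let t : B.carrier → A.carrier := fun x =>
    if hx : x ∈ Metric.closedBall (0 : B.carrier) 1 then (s ⟨x, hx⟩).1 else 0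
  have hts : ∀ x : Metric.closedBall (0 : B.carrier) 1, t x.1 = (s x).1 := fun x => dif_pos x.2
  refine ⟨t, Ban.Hom.norm_apply_le f, Ban.Hom.norm_apply_le g, fun x hx => ?_, fun x hx => ?_,
    fun x y hx hy => ?_, fun a ha => ?_⟩
  · rw [hts ⟨x, mem_closedBall_zero_iff.2 hx⟩]
    exact mem_closedBall_zero_iff.1 (s _).2
  · rw [hts ⟨x, mem_closedBall_zero_iff.2 hx⟩]
    exact congrArg Subtype.val (ht ⟨x, mem_closedBall_zero_iff.2 hx⟩)
  · rw [hts ⟨x, mem_closedBall_zero_iff.2 hx⟩, hts ⟨y, mem_closedBall_zero_iff.2 hy⟩,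
      ← dist_eq_norm, ← dist_eq_norm]
    have h1 := (S.rightSection.lipschitz.comp h.lipschitz).dist_le_mul
      ⟨x, mem_closedBall_zero_iff.2 hx⟩ ⟨y, mem_closedBall_zero_iff.2 hy⟩
    rw [mul_one, NNReal.coe_one, one_mul] at h1
    replace h1 := (congrArg₂ dist (ht' ⟨x, mem_closedBall_zero_iff.2 hx⟩)
      (ht' ⟨y, mem_closedBall_zero_iff.2 hy⟩)).trans_le h1
    exact h1
  · let a' : Metric.closedBall (0 : A.carrier) 1 := ⟨a, mem_closedBall_zero_iff.2 ha⟩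
    have e1 := hts ((unitBallFunctor.map f).toFun a')
    have e2 := hts ((unitBallFunctor.map g).toFun a')
    have e3 := (ht' ((unitBallFunctor.map f).toFun a')).trans
      ((congrArg S.rightSection.toFun (hc a')).trans
        (ht' ((unitBallFunctor.map g).toFun a')).symm)
    change f.toCLM (t (f.toCLM a)) = f.toCLM (t (g.toCLM a))
    refine (congrArg f.toCLM e1).trans (Eq.trans ?_ (congrArg f.toCLM e2).symm)
    exact congrArg Subtype.val e3

/-- The unit ball functor maps the coequalizer of a pair that is split on unit balls to a
coequalizer. -/
theorem nonempty_isColimit_map_coeqπ {A B : Ban.{u}} (f g : A ⟶ B)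
    [unitBallFunctor.IsSplitPair f g] :
    Nonempty (IsColimit (Cofork.ofπ (unitBallFunctor.map (Ban.coeqπ f g))
      (by rw [← Functor.map_comp, ← Functor.map_comp, Ban.coeq_condition]) :
      Cofork (unitBallFunctor.map f) (unitBallFunctor.map g))) := by
  obtain ⟨t, h⟩ := exists_unitBallSplitting f g
  have hsurj : ∀ z : Metric.closedBall (0 : (Ban.coeq f g).carrier) 1,
      ∃ x : Metric.closedBall (0 : B.carrier) 1, (Ban.coeqπ f g).toCLM x.1 = z.1 := fun z => by
    obtain ⟨x, hx, hxz⟩ := h.exists_mk_eq z.1 (mem_closedBall_zero_iff.1 z.2)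
    exact ⟨⟨x, mem_closedBall_zero_iff.2 hx⟩, hxz⟩
  choose σ hσ using hsurj
  refine ⟨Cofork.IsColimit.mk' _ fun s => ?_⟩
  let k : Metric.closedBall (0 : B.carrier) 1 → s.pt.carrier := s.π.toFun
  have hk : LipschitzWith 1 k := s.π.lipschitz
  -- With `e = f ∘ t`, coequalizing gives `k = k ∘ e`, so the bound on `‖e x - e y‖` passes to `k`.
  -- Hence `k ∘ σ` is nonexpanding and independent of the chosen lifts.
  have hdist : ∀ x y : Metric.closedBall (0 : B.carrier) 1,
      dist (k x) (k y) ≤ dist ((Ban.coeqπ f g).toCLM x.1) ((Ban.coeqπ f g).toCLM y.1) := by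
    let e : Metric.closedBall (0 : B.carrier) 1 → Metric.closedBall (0 : B.carrier) 1 := fun x =>
      ⟨f.toCLM (t x.1), mem_closedBall_zero_iff.2
        (h.norm_apply_le (mem_closedBall_zero_iff.1 x.2))⟩
    have hke : ∀ x, k x = k (e x) := fun x => by
      let a : Metric.closedBall (0 : A.carrier) 1 :=
        ⟨t x.1, mem_closedBall_zero_iff.2 (h.norm_section_le _ (mem_closedBall_zero_iff.1 x.2))⟩
      have h1 : k ((unitBallFunctor.map f).toFun a) = k ((unitBallFunctor.map g).toFun a) :=
        congrFun (congrArg CMet.Hom.toFun s.condition) a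
      have h2 : (unitBallFunctor.map g).toFun a = x :=
        Subtype.ext (h.right_section _ (mem_closedBall_zero_iff.1 x.2))
      rw [h2] at h1
      exact h1.symm
    intro x y
    rw [hke x, hke y, dist_eq_norm]
    have h1 := hk.dist_le_mul (e x) (e y)
    rw [NNReal.coe_one, one_mul] at h1
    refine h1.trans ((dist_eq_norm (e x).1 (e y).1).trans_le ?_)
    exact h.dist_le_norm_mk (mem_closedBall_zero_iff.1 x.2) (mem_closedBall_zero_iff.1 y.2)
  have hkσ : ∀ z w, dist (k (σ z)) (k (σ w)) ≤ dist z w := fun z w => by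
    have := hdist (σ z) (σ w)
    rwa [hσ, hσ] at this
  have hσk : ∀ z x, (Ban.coeqπ f g).toCLM x.1 = z.1 → k (σ z) = k x := fun z x hx => by
    have := hdist (σ z) x
    rw [hσ, hx, dist_self] at this
    exact dist_le_zero.1 this
  let d : CMet.Hom (unitBallFunctor.obj (Ban.coeq f g)) s.pt :=
    ⟨fun z => k (σ z), LipschitzWith.of_dist_le_mul fun z w => by
      rw [NNReal.coe_one, one_mul]
      exact hkσ z w⟩
  refine ⟨d, CMet.Hom.ext (funext fun x => hσk _ x rfl), fun {m} hm => CMet.Hom.ext (funext fun z => ?_)⟩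
  have h1 : m.toFun ((unitBallFunctor.map (Ban.coeqπ f g)).toFun (σ z)) = k (σ z) :=
      congrFun (congrArg CMet.Hom.toFun hm) (σ z)
  have h2 : (unitBallFunctor.map (Ban.coeqπ f g)).toFun (σ z) = z := Subtype.ext (hσ z)
  rw [h2] at h1
  exact h1

instance : Monad.HasCoequalizerOfIsSplitPair unitBallFunctor.{u} := ⟨fun _ _ _ => inferInstance⟩

instance : Monad.PreservesColimitOfIsSplitPair unitBallFunctor.{u} :=
  ⟨fun f g _ => preservesColimit_of_preserves_colimit_cocone (Ban.coeqIsColimit f g)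
    ((isColimitMapCoconeCoforkEquiv _ _).symm (nonempty_isColimit_map_coeqπ f g).some)⟩

/-! ### Reflection of isomorphisms. -/

namespace Ban

theorem isIso_of_norm_eq_of_surjective {E F : Ban.{u}} (f : E ⟶ F)
    (hf : ∀ x, ‖f.toCLM x‖ = ‖x‖) (hs : Function.Surjective f.toCLM) : IsIso f := by
  let i : E.carrier ≃ₗᵢ[ℂ] F.carrier :=
    LinearIsometryEquiv.ofSurjective ⟨f.toCLM.toLinearMap, hf⟩ hs
  refine ⟨(⟨i.symm.toContinuousLinearEquiv.toContinuousLinearMap,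
    ContinuousLinearMap.opNorm_le_bound _ zero_le_one fun y => by
      rw [one_mul]; exact (i.symm.norm_map y).le⟩ : Hom F E),
    Hom.ext (ContinuousLinearMap.ext i.symm_apply_apply),
    Hom.ext (ContinuousLinearMap.ext i.apply_symm_apply)⟩

end Ban

theorem exists_smul_mem_closedBall {E : Type*} [NormedAddCommGroup E] [NormedSpace ℂ E] (x : E) :
    ∃ c : ℂ, c ≠ 0 ∧ c • x ∈ Metric.closedBall (0 : E) 1 := by
  have h : 0 < 1 + ‖x‖ := by positivity
  refine ⟨((1 + ‖x‖)⁻¹ : ℝ), Complex.ofReal_ne_zero.2 (inv_ne_zero h.ne'), ?_⟩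
  rw [mem_closedBall_zero_iff, norm_smul, Complex.norm_real, Real.norm_of_nonneg (by positivity),
    inv_mul_le_one₀ h]
  linarith

instance : unitBallFunctor.{u}.ReflectsIsomorphisms where
  reflects {E F} f hf := by
    obtain ⟨g, hfg, hgf⟩ := hf.out
    have h1 : ∀ x : Metric.closedBall (0 : E.carrier) 1,
        g.toFun ((unitBallFunctor.map f).toFun x) = x := fun x =>
      congrFun (congrArg CMet.Hom.toFun hfg) x
    have h2 : ∀ y : Metric.closedBall (0 : F.carrier) 1,
        (unitBallFunctor.map f).toFun (g.toFun y) = y := fun y =>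
      congrFun (congrArg CMet.Hom.toFun hgf) y
    refine Ban.isIso_of_norm_eq_of_surjective f (fun x => ?_) (fun y => ?_)
    · refine le_antisymm (Ban.Hom.norm_apply_le f x) ?_
      -- Once `x` is scaled into the ball, comparing it with the origin under the nonexpanding
      -- inverse gives the lower bound on the norm.
      obtain ⟨c, hc, hx⟩ := exists_smul_mem_closedBall x
      let x' : Metric.closedBall (0 : E.carrier) 1 := ⟨c • x, hx⟩
      let o : Metric.closedBall (0 : E.carrier) 1 := ⟨0, by simp⟩
      have h3 := g.lipschitz.dist_le_mul ((unitBallFunctor.map f).toFun x')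
        ((unitBallFunctor.map f).toFun o)
      rw [h1, h1, NNReal.coe_one, one_mul] at h3
      have h4 : dist (c • x) 0 ≤ dist (f.toCLM (c • x)) (f.toCLM 0) := h3
      rw [map_zero, dist_zero_right, dist_zero_right, map_smul, norm_smul, norm_smul] at h4
      exact le_of_mul_le_mul_left h4 (norm_pos_iff.2 hc)
    · obtain ⟨c, hc, hy⟩ := exists_smul_mem_closedBall y
      let x : Metric.closedBall (0 : E.carrier) 1 := g.toFun ⟨c • y, hy⟩
      have h3 : f.toCLM x.1 = c • y := congrArg Subtype.val (h2 ⟨c • y, hy⟩)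
      exact ⟨c⁻¹ • x.1, by rw [map_smul, h3, inv_smul_smul₀ hc]⟩

end

theorem theorem4p1 : Nonempty (MonadicRightAdjoint unitBallFunctor.{u}) :=
  ⟨Monad.monadicOfHasPreservesGSplitCoequalizersOfReflectsIsomorphisms freeBanachAdjunction⟩
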